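/- **Theorem 1.1.** Let $M$ be a matroid on a finite ground set $E$, with set of bases $\mathcal{B}(M)$ and independence complex $\mathcal{I}(M)$ (the simplicial complex of independent sets, whose facets are the bases). Let $P_M=\operatorname{conv}\{\chi_B : B\in\mathcal{B}(M)\}\subset\mathbb{R}^E$ be its matroid polytope, where $\chi_B$ is the characteristic vector of $B$. Let $P_M^*$ be a dual polytope of $P_M$, that is, a polytope with an inclusion-reversing bijection from the faces of $P_M$ to the faces of $P_M^*$ ($\emptyset$ and the polytope itself count as faces). For $B\in\mathcal{B}(M)$ let $F_B$ be the facet of $P_M^*$ that corresponds to the vertex $\chi_B$ of $P_M$. Let $<$ be a total order on $\mathcal{B}(M)$, and let $<_\bullet$ be the order on the facets of $P_M^*$ given by $F_B<_\bullet F_{B'}$ if and only if $B<B'$. If $<_\bullet$ is a shelling order of $P_M^*$, then $<$ is a shelling order of $\mathcal{I}(M)$. Here, a shelling order of a pure simplicial complex $\Delta$ is a total order $F_1<\dots<F_k$ of its facets such that for each $j\ge 2$ the complex $\langle F_1,\dots,F_{j-1}\rangle\cap\langle F_j\rangle$ is pure of dimension $\dim\Delta-1$, where $\langle F_1,\dots,F_i\rangle$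 is the complex of all subsets of $F_1,\dots,F_i$ and a set $F$ has dimension $|F|-1$. A shelling order of a polytope $P$ is a total order $F_1,\dots,F_k$ of its facets (faces of dimension $\dim P-1$, with $\dim\emptyset=-1$) such that: if $\dim P\le 1$, there is no further condition; if $\dim P=2$, each edge $F_j$ with $j\ge2$ shares a vertex with some $F_i$, $i<j$; if $\dim P\ge3$, for each $j\ge 2$ there are a shelling order $G_1,\dots,G_m$ of the polytope $F_j$ and an $r$ with $1\le r\le m$ such that $F_j\cap\bigcup_{i<j}F_i=G_1\cup\dots\cup G_r$. -/

import Mathlib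

namespace MatroidShelling

/-! Simplicial complexes. A complex is represented by its set of faces (the empty face included). -/

section Simplicial

variable {α : Type*}

/-- A (finite, abstract) simplicial complex: a non-empty finite family of sets that is closed
under taking subsets. -/
def IsComplex (Δ : Set (Set α)) : Prop :=
  Δ.Finite ∧ Δ.Nonempty ∧ ∀ F ∈ Δ, ∀ G ⊆ F, G ∈ Δ

/-- The facets of a complex: its inclusion-maximal faces. -/
def complexFacets (Δ : Set (Set α)) : Set (Set α) :=
  {F | Maximal (fun G => G ∈ Δ) F}

/-- The dimension of a face: one less than its number of elements. -/
noncomputable def faceDim (F : Set α) : ℤ := (F.ncard : ℤ) - 1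

/-- The dimension of a complex: the largest dimension of a face. -/
noncomputable def complexDim (Δ : Set (Set α)) : ℤ := sSup (faceDim '' Δ)

/-- A complex is pure if all its facets have the same dimension. -/
def IsPure (Δ : Set (Set α)) : Prop :=
  ∀ F ∈ complexFacets Δ, ∀ G ∈ complexFacets Δ, faceDim F = faceDim G

/-- The complex generated by a family of sets: all subsets of members of the family. -/
def generated (𝒢 : Set (Set α)) : Set (Set α) := {S | ∃ G ∈ 𝒢, S ⊆ G}

/-- The sequence `F 0, F 1, …, F (k - 1)` is a shelling order of the pure simplicial complex `Δ`:
it lists every facet of `Δ` exactly once and, for every `j` other than the first index,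
the complex `⟨F i : i < j⟩ ∩ ⟨F j⟩` is pure of dimension `dim Δ - 1`. -/
def IsComplexShelling (Δ : Set (Set α)) {k : ℕ} (F : Fin k → Set α) : Prop :=
  IsComplex Δ ∧ IsPure Δ ∧
  Function.Injective F ∧ Set.range F = complexFacets Δ ∧
  ∀ j : Fin k, 0 < j.val →
    IsPure (generated (F '' Set.Iio j) ∩ generated {F j}) ∧
    complexDim (generated (F '' Set.Iio j) ∩ generated {F j}) = complexDim Δ - 1

end Simplicial

/-! Polytopes, their faces, and their shellings. -/

section Polytope

variable {V : Type*} [AddCommGroup V] [Module ℝ V]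

/-- A polytope is the convex hull of finitely many points. -/
def IsPolytope (P : Set V) : Prop := ∃ s : Finset V, P = convexHull ℝ (s : Set V)

open Classical in
/-- The dimension of (the affine hull of) a set, with `dim ∅ = -1`. -/
noncomputable def polyDim (P : Set V) : ℤ :=
  if P = ∅ then -1 else (Module.finrank ℝ (vectorSpan ℝ P) : ℤ)

variable [TopologicalSpace V]

/-- The face poset of `P`, ordered by inclusion: `F` is a face if it is empty or the set of
points of `P` at which some (continuous) linear functional attains its maximum over `P`.
Both `∅` and `P` itself are faces. -/
abbrev Face (P : Set V) : Type _ := {F : Set V // IsExposed ℝ P F}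

/-- The facets of `P`: the faces of dimension one less than `P`. -/
def polyFacets (P : Set V) : Set (Set V) :=
  {F | IsExposed ℝ P F ∧ polyDim F + 1 = polyDim P}

/-- `F 0, …, F (k - 1)` lists every facet of `P` exactly once. -/
def ListsFacets (P : Set V) {k : ℕ} (F : Fin k → Set V) : Prop :=
  Function.Injective F ∧ Set.range F = polyFacets P

/-- `F` is a shelling order of the facets of the `d`-dimensional polytope `P`.
* `d ≤ 1`: every order of the facets is a shelling order.
* `d = 2`: every edge but the first shares a vertex with a previous edge.
* `d ≥ 3`: for every facet `F j` but the first, `F j ∩ ⋃ i < j, F i` is the union of the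
  members of a non-empty initial segment of a shelling order `G` of `F j`. -/
def IsShellingOfDim : (d : ℕ) → (P : Set V) → {k : ℕ} → (F : Fin k → Set V) → Prop
  | 0, P, _, F => ListsFacets P F
  | 1, P, _, F => ListsFacets P F
  | 2, P, k, F => ListsFacets P F ∧
      ∀ j : Fin k, 0 < j.val →
        ∃ i < j, ∃ v : V, IsExposed ℝ (F i) {v} ∧ IsExposed ℝ (F j) {v}
  | d + 3, P, k, F => ListsFacets P F ∧
      ∀ j : Fin k, 0 < j.val →
        ∃ (m : ℕ) (G : Fin m → Set V), IsShellingOfDim (d + 2) (F j) G ∧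
          ∃ r : ℕ, 1 ≤ r ∧ r ≤ m ∧
            F j ∩ (⋃ i : Fin k, ⋃ _ : i < j, F i) = ⋃ i : Fin m, ⋃ _ : i.val < r, G i

/-- `F` is a shelling order of the polytope `P`. -/
def IsPolytopeShelling (P : Set V) {k : ℕ} (F : Fin k → Set V) : Prop :=
  IsShellingOfDim (polyDim P).toNat P F

end Polytope

/-! Matroids. -/

section Matroid

variable {α : Type*}

/-- The independence complex of a matroid. -/
def indepComplex (M : Matroid α) : Set (Set α) := {I | M.Indep I}

/-- The characteristic vector of `S` in `ℝ^E`, `E` the ground set of `M`. -/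
noncomputable def charVec (M : Matroid α) (S : Set α) : M.E → ℝ :=
  Set.indicator {e : M.E | (e : α) ∈ S} (fun _ => 1)

/-- The matroid polytope: the convex hull of the characteristic vectors of the bases. -/
def matroidPolytope (M : Matroid α) : Set (M.E → ℝ) :=
  convexHull ℝ {x | ∃ B, M.IsBase B ∧ x = charVec M B}

theorem matroidPolytope_subset_cube (M : Matroid α) :
    matroidPolytope M ⊆ Set.univ.pi (fun _ : M.E => Set.Icc (0 : ℝ) 1) := by
  refine convexHull_min ?_ (convex_pi fun _ _ => convex_Icc 0 1)
  rintro x ⟨B, -, rfl⟩ e -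
  by_cases h : (e : α) ∈ B <;> simp [charVec, Set.indicator, h]

/-- The characteristic vector of a basis is a vertex of the matroid polytope. -/
theorem isExposed_charVec (M : Matroid α) [M.Finite] {B : Set α} (hB : M.IsBase B) :
    IsExposed ℝ (matroidPolytope M) {charVec M B} := by
  classical
  intro _
  have : Finite M.E := M.ground_finite
  have : Fintype M.E := Fintype.ofFinite _
  let l : (M.E → ℝ) →L[ℝ] ℝ :=
    ∑ e : M.E, (2 * charVec M B e - 1) • ContinuousLinearMap.proj (R := ℝ) (φ := fun _ => ℝ) e
  have hl : ∀ x, l x = ∑ e : M.E, (2 * charVec M B e - 1) * x e := by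
    intro x
    simp [l]
  have hval : ∀ e : M.E, charVec M B e = 0 ∨ charVec M B e = 1 := by
    intro e
    by_cases h : (e : α) ∈ B <;> simp [charVec, Set.indicator, h]
  have hterm : ∀ x ∈ matroidPolytope M, ∀ e : M.E,
      (2 * charVec M B e - 1) * x e ≤ (2 * charVec M B e - 1) * charVec M B e := by
    intro x hx e
    have h01 := matroidPolytope_subset_cube M hx e (Set.mem_univ e)
    rcases hval e with h | h <;> rw [h] <;> linarith [h01.1, h01.2]
  have hmem : charVec M B ∈ matroidPolytope M := subset_convexHull ℝ _ ⟨B, hB, rfl⟩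
  refine ⟨l, ?_⟩
  ext x
  simp only [Set.mem_singleton_iff, Set.mem_ofPred_eq]
  constructor
  · rintro rfl
    refine ⟨hmem, fun y hy => ?_⟩
    rw [hl, hl]
    exact Finset.sum_le_sum fun e _ => hterm y hy e
  · rintro ⟨hx, hmax⟩
    have hle := hmax _ hmem
    rw [hl, hl] at hle
    have heq := (Finset.sum_eq_sum_iff_of_le fun e _ => hterm x hx e).1
      (le_antisymm (Finset.sum_le_sum fun e _ => hterm x hx e) hle)
    funext e
    have h := heq e (Finset.mem_univ e)
    rcases hval e with h' | h' <;> rw [h'] at h ⊢ <;> linarith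

/-- The vertex of the matroid polytope that corresponds to a basis, as a face. -/
noncomputable def vertexFace (M : Matroid α) [M.Finite] (B : {B : Set α // M.IsBase B}) :
    Face (matroidPolytope M) :=
  ⟨{charVec M B.1}, isExposed_charVec M B.2⟩

/-- Let `Φ` be an inclusion-reversing bijection from the faces of the matroid polytope to the
faces of `Q`, so that `Q` is a dual polytope. Then `dualFacet M Φ B` is the facet of `Q` that
corresponds to the basis `B`: the face dual to the vertex `charVec M B`. -/
noncomputable def dualFacet (M : Matroid α) [M.Finite]
    {V : Type*} [AddCommGroup V] [Module ℝ V] [TopologicalSpace V] {Q : Set V}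
    (Φ : Face (matroidPolytope M) ≃o (Face Q)ᵒᵈ) (B : {B : Set α // M.IsBase B}) : Set V :=
  (OrderDual.ofDual (Φ (vertexFace M B))).1

end Matroid

end MatroidShelling

/-! It suffices to find, for all `i < j`, some `t < j` with `b i ∩ b j ⊆ b t` and `b t` adjacent to
`b j` (differing by one exchange). Let `I = b i ∩ b j`. The face `G` of the matroid polytope where
the `I`-coordinates have maximal sum has as vertices the bases containing `I`, so its dual face lies
in both facets `F i` and `F j` of `Q`. By `exists_ridge`, the shelling of `Q` gives `t < j` such
that `F t` contains this dual face and `F t ∩ F j` is a ridge. Dualizing back, `b t` is a vertex of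
`G`, so `I ⊆ b t`; and `b t` is a vertex of a face covering the vertex of `b j`, so by
`ncard_inter_add_one_of_covBy` the two bases are adjacent. -/

open Set

/-! ### Symmetric basis exchange. -/

namespace Matroid

variable {α : Type*} {M : Matroid α}

/-- The symmetric exchange property of bases. -/
theorem IsBase.exists_symm_exchange {B B' : Set α} (hB : M.IsBase B) (hB' : M.IsBase B') {e : α}
    (he : e ∈ B \ B') :
    ∃ f ∈ B' \ B, M.IsBase (insert f (B \ {e})) ∧ M.IsBase (insert e (B' \ {f})) := by
  have heE : e ∈ M.E := hB.subset_ground he.1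
  have hC := hB'.fundCircuit_isCircuit heE he.2
  have hsub := M.fundCircuit_subset_insert e B'
  -- Otherwise the closure of `B \ {e}` would contain the rest of the circuit, hence `e` itself.
  obtain ⟨f, hfC, hf⟩ : ∃ f ∈ M.fundCircuit e B' \ {e}, f ∉ M.closure (B \ {e}) := by
    by_contra! h
    refine hB.indep.notMem_closure_sdiff_of_mem he.1 ?_
    exact M.closure_subset_closure_of_subset_closure h
      (hC.mem_closure_sdiff_singleton_of_mem (M.mem_fundCircuit e B'))
  have hfB' : f ∈ B' := (hsub hfC.1).resolve_left hfC.2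
  have hfE : f ∈ M.E := hB'.subset_ground hfB'
  have hfB : f ∉ B := fun h =>
    hf (M.subset_closure (B \ {e}) (sdiff_subset.trans hB.subset_ground) ⟨h, hfC.2⟩)
  refine ⟨f, ⟨hfB', hfB⟩, hB.exchange_base_of_notMem_closure he.1 hf, ?_⟩
  have hi : M.Indep (insert e B' \ {f}) :=
    (hB'.indep.mem_fundCircuit_iff (by rwa [hB'.closure_eq]) he.2).1 hfC.1
  have := hB'.exchange_isBase_of_indep' hfB' he.2 hi
  rwa [← insert_sdiff_singleton_comm (Ne.symm hfC.2)] at this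

end Matroid

namespace MatroidShelling

/-! ### Faces, dimension and ridges in a shelling. -/

section Polytope

/-- A convex subset of `C` that is covered by finitely many exposed faces of `C` lies in one of
them. -/
theorem exists_subset_of_subset_iUnion_isExposed {V ι : Type*} [AddCommGroup V] [Module ℝ V]
    [TopologicalSpace V] [Finite ι] {A C : Set V} {H : ι → Set V} (hA : Convex ℝ A)
    (hne : A.Nonempty) (hAC : A ⊆ C) (hH : ∀ i, IsExposed ℝ C (H i)) (hcov : A ⊆ ⋃ i, H i) :
    ∃ i, A ⊆ H i := by
  have := Fintype.ofFinite ι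
  by_contra! h
  choose a ha haH using fun i => not_subset.1 (h i)
  obtain ⟨i₀, -⟩ := mem_iUnion.1 (hcov hne.some_mem)
  have hcard : (0 : ℝ) < Fintype.card ι := by
    exact_mod_cast Fintype.card_pos_iff.2 ⟨i₀⟩
  set c : ℝ := (Fintype.card ι : ℝ)⁻¹ with hc
  have hc0 : 0 < c := inv_pos.2 hcard
  -- The average of points `a i ∉ H i` lies in some `H k`. A functional exposing `H k` is maximal at
  -- the average, hence at every `a i`, so `a k ∈ H k`.
  have hx : ∑ i, c • a i ∈ A :=
    hA.sum_mem (fun _ _ => hc0.le) (by simp [hc, hcard.ne']) fun i _ => ha i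
  obtain ⟨k, hk⟩ := mem_iUnion.1 (hcov hx)
  obtain ⟨l, hl⟩ := hH k ⟨_, hk⟩
  rw [hl] at hk
  have hsum : ∑ i, c * l (a i) = ∑ _i : ι, c * l (∑ i, c • a i) := by
    conv_rhs => rw [Finset.sum_const, Finset.card_univ, nsmul_eq_mul, ← mul_assoc, hc,
      mul_inv_cancel₀ hcard.ne', one_mul, ← hc]
    simp
  have heq := (Finset.sum_eq_sum_iff_of_le fun i _ =>
    mul_le_mul_of_nonneg_left (hk.2 _ (hAC (ha i))) hc0.le).1 hsum k (Finset.mem_univ k)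
  refine haH k ?_
  rw [hl]
  refine ⟨hAC (ha k), fun y hy => (hk.2 y hy).trans (mul_left_cancel₀ hc0.ne' heq).ge⟩

variable {V : Type*} [NormedAddCommGroup V] [NormedSpace ℝ V]

theorem neg_one_le_polyDim (P : Set V) : -1 ≤ polyDim P := by
  unfold polyDim
  split_ifs <;> omega

theorem polyDim_nonneg {P : Set V} (h : P.Nonempty) : 0 ≤ polyDim P := by
  simp [polyDim, h.ne_empty]

theorem nonempty_of_polyDim_nonneg {P : Set V} (h : 0 ≤ polyDim P) : P.Nonempty := by
  by_contra hP
  simp [polyDim, not_nonempty_iff_eq_empty.1 hP] at h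

theorem IsShellingOfDim.listsFacets {d : ℕ} {P : Set V} {k : ℕ} {F : Fin k → Set V}
    (h : IsShellingOfDim d P F) : ListsFacets P F := by
  match d, h with
  | 0, h => exact h
  | 1, h => exact h
  | 2, h => exact h.1
  | _ + 3, h => exact h.1

theorem ListsFacets.isExposed {P : Set V} {k : ℕ} {F : Fin k → Set V} (h : ListsFacets P F)
    (i : Fin k) : IsExposed ℝ P (F i) :=
  (h.2 ▸ mem_range_self i : F i ∈ polyFacets P).1

theorem ListsFacets.polyDim_add_one {P : Set V} {k : ℕ} {F : Fin k → Set V} (h : ListsFacets P F)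
    (i : Fin k) : polyDim (F i) + 1 = polyDim P :=
  (h.2 ▸ mem_range_self i : F i ∈ polyFacets P).2

variable [FiniteDimensional ℝ V]

theorem polyDim_mono {F P : Set V} (h : F ⊆ P) : polyDim F ≤ polyDim P := by
  obtain rfl | hF := F.eq_empty_or_nonempty
  · simpa [polyDim] using neg_one_le_polyDim P
  simp only [polyDim, hF.ne_empty, (hF.mono h).ne_empty, if_false]
  exact_mod_cast Submodule.finrank_mono (vectorSpan_mono ℝ h)

/-- A proper face has smaller dimension. -/
theorem polyDim_lt_of_isExposed {F P : Set V} (h : IsExposed ℝ P F) (hne : F ≠ P) :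
    polyDim F < polyDim P := by
  have hsub := h.subset
  obtain ⟨x, hxP, hxF⟩ := not_subset.1 fun h' => hne (hsub.antisymm h')
  obtain rfl | hF := F.eq_empty_or_nonempty
  · have := polyDim_nonneg ⟨x, hxP⟩
    simp only [polyDim, if_true] at this ⊢
    omega
  simp only [polyDim, hF.ne_empty, (hF.mono hsub).ne_empty, if_false]
  obtain ⟨l, hl⟩ := h hF
  obtain ⟨y, hy⟩ := hF
  have hker : vectorSpan ℝ F ≤ LinearMap.ker l.toLinearMap := by
    rw [vectorSpan_def, Submodule.span_le]
    rintro _ ⟨a, ha, b, hb, rfl⟩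
    rw [hl] at ha hb
    have := le_antisymm (ha.2 b hb.1) (hb.2 a ha.1)
    simp [this]
  have hlt : vectorSpan ℝ F < vectorSpan ℝ P := by
    refine lt_of_le_of_ne (vectorSpan_mono ℝ hsub) fun heq => hxF ?_
    have hmem : x - y ∈ vectorSpan ℝ F := heq ▸ vsub_mem_vectorSpan ℝ hxP (hsub hy)
    have h0 : l x = l y := by
      have := hker hmem
      simpa [sub_eq_zero] using this
    rw [hl] at hy ⊢
    exact ⟨hxP, fun z hz => h0 ▸ hy.2 z hz⟩
  exact_mod_cast Submodule.finrank_lt_finrank_of_lt hlt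

/-- Each strict inclusion of faces raises the dimension by at least one, so nothing fits in between.
-/
theorem covBy_of_polyDim_le {P : Set V} {F G : Face P} (hlt : F < G)
    (hdim : polyDim G.1 ≤ polyDim F.1 + 1) : F ⋖ G := by
  refine ⟨hlt, fun H hFH hHG => ?_⟩
  have h1 := polyDim_lt_of_isExposed (F.2.mono H.2.subset hFH.le) fun h => hFH.ne (Subtype.ext h)
  have h2 := polyDim_lt_of_isExposed (H.2.mono G.2.subset hHG.le) fun h => hHG.ne (Subtype.ext h)
  omega

theorem ListsFacets.inter_ssubset {P : Set V} {k : ℕ} {F : Fin k → Set V} (h : ListsFacets P F)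
    {i j : Fin k} (hij : i ≠ j) : F i ∩ F j ⊂ F j := by
  refine ssubset_of_subset_of_ne inter_subset_right fun heq => ?_
  have hsub : F j ⊆ F i := inter_eq_right.1 heq
  have hlt := polyDim_lt_of_isExposed ((h.isExposed j).mono (h.isExposed i).subset hsub)
    fun h' => hij (h.1 h').symm
  have := h.polyDim_add_one i
  have := h.polyDim_add_one j
  omega

/-- In a shelling of a polytope, a face that `F j` shares with an earlier facet is contained in a
ridge that `F j` shares with an earlier facet. -/
theorem IsPolytopeShelling.exists_ridge {P : Set V} (hP : Convex ℝ P) {k : ℕ} {F : Fin k → Set V}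
    (h : IsPolytopeShelling P F) {A : Set V} (hA : IsExposed ℝ P A) {i j : Fin k} (hij : i < j)
    (hAi : A ⊆ F i) (hAj : A ⊆ F j) :
    ∃ t < j, A ⊆ F t ∧ polyDim (F j) ≤ polyDim (F t ∩ F j) + 1 := by
  have hL : ListsFacets P F := IsShellingOfDim.listsFacets h
  have hdim := hL.polyDim_add_one j
  have hj : 0 < j.val := (Nat.zero_le _).trans_lt hij
  unfold IsPolytopeShelling at h
  generalize hd : (polyDim P).toNat = d at h
  match d, h with
  -- Here `F j` has dimension at most 0, and even `∅` has dimension -1.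
  | 0, h | 1, h =>
    refine ⟨i, hij, hAi, ?_⟩
    have := neg_one_le_polyDim (F i ∩ F j)
    omega
  | 2, h =>
    -- If `A` is empty, `F i` may be disjoint from `F j`, so the edge supplied by the shelling is
    -- used instead.
    obtain rfl | hne := A.eq_empty_or_nonempty
    · obtain ⟨t, htj, v, hvt, hvj⟩ := h.2 j hj
      refine ⟨t, htj, empty_subset _, ?_⟩
      have := polyDim_nonneg (P := F t ∩ F j)
        ⟨v, hvt.subset (mem_singleton v), hvj.subset (mem_singleton v)⟩
      omega
    · refine ⟨i, hij, hAi, ?_⟩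
      have := polyDim_nonneg (hne.mono (subset_inter hAi hAj))
      omega
  | d + 3, h =>
    obtain ⟨m, G, hG, r, hr, hrm, hU⟩ := h.2 j hj
    have hGL := hG.listsFacets
    have hFj : Convex ℝ (F j) := (hL.isExposed j).convex hP
    obtain ⟨s, hsr, hAs⟩ : ∃ s : Fin m, s.val < r ∧ A ⊆ G s := by
      obtain rfl | hne := A.eq_empty_or_nonempty
      · exact ⟨⟨0, by omega⟩, hr, empty_subset _⟩
      obtain ⟨s, hs⟩ := exists_subset_of_subset_iUnion_isExposed
        (H := fun s : {s : Fin m // s.val < r} => G s) (hA.convex hP) hne hAj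
        (fun s => hGL.isExposed s) fun x hx => by
          have hx' : x ∈ F j ∩ ⋃ i : Fin k, ⋃ _ : i < j, F i :=
            ⟨hAj hx, mem_iUnion₂.2 ⟨i, hij, hAi hx⟩⟩
          rw [hU] at hx'
          obtain ⟨s, hs, hxs⟩ := mem_iUnion₂.1 hx'
          exact mem_iUnion.2 ⟨⟨s, hs⟩, hxs⟩
      exact ⟨s, s.2, hs⟩
    have hGdim := hGL.polyDim_add_one s
    have hGF := (hGL.isExposed s).subset
    -- The ridge `G s` is itself covered by earlier facets, so a single `F t` contains it, and `A`
    -- with it.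
    obtain ⟨t, ht⟩ := exists_subset_of_subset_iUnion_isExposed
      (H := fun t : {t : Fin k // t < j} => F t) ((hGL.isExposed s).convex hFj)
      (nonempty_of_polyDim_nonneg (by omega)) (hGF.trans (hL.isExposed j).subset)
      (fun t => hL.isExposed t) fun x hx => by
        have hx' : x ∈ ⋃ i : Fin m, ⋃ _ : i.val < r, G i := mem_iUnion₂.2 ⟨s, hsr, hx⟩
        rw [← hU] at hx'
        obtain ⟨t, ht, hxt⟩ := mem_iUnion₂.1 hx'.2
        exact mem_iUnion.2 ⟨⟨t, ht⟩, hxt⟩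
    refine ⟨t, t.2, hAs.trans ht, ?_⟩
    have := polyDim_mono (subset_inter ht hGF)
    omega

end Polytope

/-! ### Faces of the matroid polytope. -/

section Matroid

variable {α : Type*} (M : Matroid α)

theorem charVec_apply (S : Set α) (e : M.E) [Decidable ((e : α) ∈ S)] :
    charVec M S e = if (e : α) ∈ S then 1 else 0 := by
  by_cases h : (e : α) ∈ S <;> simp [charVec, indicator, h]

variable {M} in
theorem charVec_injOn : InjOn (charVec M) {S | S ⊆ M.E} := by
  classical
  intro S hS T hT h
  ext x
  constructor <;> intro hx
  · have := congrFun h ⟨x, hS hx⟩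
    simpa [charVec_apply, hx] using this
  · have := congrFun h ⟨x, hT hx⟩
    simpa [charVec_apply, hx] using this

open Classical in
/-- The functional on `ℝ^E` that sums the coordinates in `T`. -/
noncomputable def coordSum [M.Finite] (T : Set α) : StrongDual ℝ (M.E → ℝ) :=
  haveI : Finite M.E := M.ground_finite
  haveI := Fintype.ofFinite M.E
  ∑ e : M.E, charVec M T e • ContinuousLinearMap.proj (R := ℝ) (φ := fun _ => ℝ) e

theorem coordSum_charVec [M.Finite] (T : Set α) {S : Set α} (hS : S ⊆ M.E) :
    coordSum M T (charVec M S) = ((S ∩ T).ncard : ℝ) := by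
  classical
  have : Finite M.E := M.ground_finite
  let := Fintype.ofFinite M.E
  have himg : S ∩ T = Subtype.val '' {e : M.E | (e : α) ∈ S ∩ T} := by
    ext x
    simp only [mem_image, mem_ofPred_eq, Subtype.exists, exists_and_right, exists_eq_right]
    exact ⟨fun h => ⟨hS h.1, h⟩, fun h => h.2⟩
  rw [himg, ncard_image_of_injective _ Subtype.val_injective, ncard_eq_toFinset_card',
    coordSum]
  simp only [FunLike.coe_sum, Finset.sum_apply, FunLike.coe_smul,
    Pi.smul_apply, ContinuousLinearMap.proj_apply, charVec_apply, smul_eq_mul, ← ite_and,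
    mul_ite, mul_one, mul_zero, Finset.sum_boole]
  congr 2
  ext e
  simp [and_comm]

variable {M}

theorem charVec_mem_toExposed {l : StrongDual ℝ (M.E → ℝ)} {B : Set α} (hB : M.IsBase B)
    (h : ∀ B', M.IsBase B' → l (charVec M B') ≤ l (charVec M B)) :
    charVec M B ∈ l.toExposed (matroidPolytope M) := by
  refine ⟨subset_convexHull ℝ _ ⟨B, hB, rfl⟩, fun y hy => ?_⟩
  have hconv : Convex ℝ {y | l y ≤ l (charVec M B)} :=
    convex_halfSpace_le l.toLinearMap.isLinear _
  refine convexHull_min ?_ hconv hy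
  rintro _ ⟨B', hB', rfl⟩
  exact h B' hB'

theorem le_of_mem_toExposed {l : StrongDual ℝ (M.E → ℝ)} {B B' : Set α}
    (h : charVec M B ∈ l.toExposed (matroidPolytope M)) (hB' : M.IsBase B') :
    l (charVec M B') ≤ l (charVec M B) :=
  h.2 _ (subset_convexHull ℝ _ ⟨B', hB', rfl⟩)

/-- Consequently, a functional maximal at both `B` and `B'` is maximal at both exchanged bases. -/
theorem charVec_add_charVec_exchange {B B' : Set α} {e f : α} (he : e ∈ B \ B')
    (hf : f ∈ B' \ B) :
    charVec M (insert f (B \ {e})) + charVec M (insert e (B' \ {f})) =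
      charVec M B + charVec M B' := by
  classical
  funext x
  simp only [Pi.add_apply, charVec_apply, mem_insert_iff, mem_sdiff, mem_singleton_iff]
  obtain ⟨x, hx⟩ := x
  by_cases h1 : x = e
  · subst h1
    have : x ≠ f := fun h => he.2 (h ▸ hf.1)
    simp [he.1, he.2, this]
  by_cases h2 : x = f
  · subst h2
    simp [hf.1, hf.2, h1]
  simp [h1, h2]

variable [M.Finite]

theorem vertexFace_le_iff {B : {B : Set α // M.IsBase B}} {g : Face (matroidPolytope M)} :
    vertexFace M B ≤ g ↔ charVec M B.1 ∈ g.1 :=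
  singleton_subset_iff

variable (M) in
/-- The face of the matroid polytope on which the coordinates in `I` have maximal sum. If `I` is
independent, then its vertices are the bases that contain `I`. -/
noncomputable def supersetFace (I : Set α) : Face (matroidPolytope M) :=
  ⟨(coordSum M I).toExposed (matroidPolytope M), ContinuousLinearMap.toExposed.isExposed⟩

theorem vertexFace_le_supersetFace {B : {B : Set α // M.IsBase B}} {I : Set α} (hI : I ⊆ B.1) :
    vertexFace M B ≤ supersetFace M I := by
  have hfin : I.Finite := M.ground_finite.subset (hI.trans B.2.subset_ground)
  refine vertexFace_le_iff.2 (charVec_mem_toExposed B.2 fun B' hB' => ?_)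
  rw [coordSum_charVec M I hB'.subset_ground, coordSum_charVec M I B.2.subset_ground,
    inter_eq_right.2 hI]
  exact_mod_cast ncard_le_ncard inter_subset_right hfin

theorem subset_of_vertexFace_le_supersetFace {B : {B : Set α // M.IsBase B}} {I : Set α}
    (hI : M.Indep I) (h : vertexFace M B ≤ supersetFace M I) : I ⊆ B.1 := by
  have hfin : I.Finite := M.ground_finite.subset hI.subset_ground
  obtain ⟨B', hB', hIB'⟩ := hI.exists_isBase_superset
  have hle := le_of_mem_toExposed (vertexFace_le_iff.1 h) hB'
  rw [coordSum_charVec M I hB'.subset_ground, coordSum_charVec M I B.2.subset_ground,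
    inter_eq_right.2 hIB'] at hle
  exact inter_eq_right.1
    (eq_of_subset_of_ncard_le inter_subset_right (by exact_mod_cast hle) hfin)

/-- Vertices of a face of the matroid polytope that covers the vertex of `B` come from bases
adjacent to `B`. -/
theorem ncard_inter_add_one_of_covBy {B B' : {B : Set α // M.IsBase B}}
    {g : Face (matroidPolytope M)} (h : vertexFace M B ⋖ g) (hB' : vertexFace M B' ≤ g)
    (hne : B' ≠ B) : (B'.1 ∩ B.1).ncard + 1 = B.1.ncard := by
  have hfin : ∀ S : {B : Set α // M.IsBase B}, S.1.Finite := fun S =>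
    M.ground_finite.subset S.2.subset_ground
  have hcard : B'.1.ncard = B.1.ncard := B'.2.ncard_eq_ncard_of_isBase B.2
  obtain ⟨e, he⟩ : (B.1 \ B'.1).Nonempty := by
    rw [sdiff_nonempty]
    exact fun hsub => hne (Subtype.ext (B.2.eq_of_subset_isBase B'.2 hsub).symm)
  obtain ⟨f, hf, hC, hD⟩ := B.2.exists_symm_exchange B'.2 he
  set C : {B : Set α // M.IsBase B} := ⟨insert f (B.1 \ {e}), hC⟩ with hCdef
  have hBC : B.1 ∩ C.1 = B.1 \ {e} := by
    ext x
    simp only [hCdef, mem_inter_iff, mem_insert_iff, mem_sdiff, mem_singleton_iff]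
    constructor
    · rintro ⟨hx, rfl | hx'⟩
      exacts [absurd hx hf.2, hx']
    · exact fun hx => ⟨hx.1, Or.inr hx⟩
  have hBCcard : (B.1 ∩ C.1).ncard + 1 = B.1.ncard := by
    rw [hBC, ncard_sdiff_singleton_add_one he.1 (hfin B)]
  have hCcard : C.1.ncard = B.1.ncard := C.2.ncard_eq_ncard_of_isBase B.2
  have hCg : vertexFace M C ≤ g := by
    have hBg := vertexFace_le_iff.1 h.le
    have hB'g := vertexFace_le_iff.1 hB'
    obtain ⟨l, hl⟩ := g.2 ⟨_, hBg⟩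
    rw [vertexFace_le_iff]
    change g.1 = l.toExposed _ at hl
    rw [hl] at hBg hB'g ⊢
    refine charVec_mem_toExposed hC fun S hS => ?_
    have hsum := congrArg l (charVec_add_charVec_exchange (M := M) he hf)
    rw [map_add, map_add] at hsum
    have h1 := le_of_mem_toExposed hB'g hD
    have h2 := le_of_mem_toExposed hBg hS
    linarith
  -- With `r` the rank, `l` is at most `2r - 1` on bases, since none equals both `B` and `C`; `B`
  -- and `C` attain this. A maximizer `S` has `|S ∩ B| ≥ r - 1`.
  set l := coordSum M B.1 + coordSum M C.1 with hl
  have hval : ∀ S : {B : Set α // M.IsBase B},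
      l (charVec M S.1) = (((S.1 ∩ B.1).ncard + (S.1 ∩ C.1).ncard : ℕ) : ℝ) := fun S => by
    simp [hl, coordSum_charVec M _ S.2.subset_ground]
  have hneBC : B ≠ C := fun heq => hf.2 (heq ▸ mem_insert f _ : f ∈ B.1)
  have hlt : ∀ S T : {B : Set α // M.IsBase B}, S ≠ T → (S.1 ∩ T.1).ncard < T.1.ncard := by
    intro S T hST
    refine ncard_lt_ncard (ssubset_of_subset_of_ne inter_subset_right fun heq => hST ?_) (hfin T)
    exact Subtype.ext (T.2.eq_of_subset_isBase S.2 (inter_eq_right.1 heq)).symm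
  have hmax : ∀ S : {B : Set α // M.IsBase B},
      (S.1 ∩ B.1).ncard + (S.1 ∩ C.1).ncard + 1 ≤ 2 * B.1.ncard := by
    intro S
    have h1 := ncard_le_ncard (inter_subset_right (s := S.1)) (hfin B)
    have h2 := ncard_le_ncard (inter_subset_right (s := S.1)) (hfin C)
    by_cases hSB : S = B
    · have := hlt S C (hSB ▸ hneBC)
      omega
    · have := hlt S B hSB
      omega
  have hedge : ∀ S : {B : Set α // M.IsBase B},
      (S.1 ∩ B.1).ncard + (S.1 ∩ C.1).ncard + 1 = 2 * B.1.ncard →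
      charVec M S.1 ∈ l.toExposed (matroidPolytope M) := by
    refine fun S hS => charVec_mem_toExposed S.2 fun T hT => ?_
    rw [hval S, hval ⟨T, hT⟩]
    have := hmax ⟨T, hT⟩
    exact_mod_cast (by omega)
  have hBmem := hedge B (by rw [inter_self]; omega)
  have hCmem := hedge C (by rw [inter_self, inter_comm]; omega)
  let T : Face (matroidPolytope M) :=
    ⟨l.toExposed (matroidPolytope M) ∩ g.1, ContinuousLinearMap.toExposed.isExposed.inter g.2⟩
  have hBT : vertexFace M B ≤ T := vertexFace_le_iff.2 ⟨hBmem, vertexFace_le_iff.1 h.le⟩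
  have hCT : vertexFace M C ≤ T := vertexFace_le_iff.2 ⟨hCmem, vertexFace_le_iff.1 hCg⟩
  -- `T` contains `C ≠ B`, so covering forces `T = g`; thus `B'` maximizes `l`.
  have hTg : T ≤ g := inter_subset_right
  obtain heq | heq := h.eq_or_eq hBT hTg
  · rw [heq, vertexFace_le_iff] at hCT
    exact absurd (Subtype.ext (charVec_injOn C.2.subset_ground B.2.subset_ground hCT)) hneBC.symm
  · rw [← heq, vertexFace_le_iff] at hB'
    have hle := le_of_mem_toExposed hB'.1 B.2
    rw [hval, hval, inter_self] at hle
    have hle' : B.1.ncard + (B.1 ∩ C.1).ncard ≤ (B'.1 ∩ B.1).ncard + (B'.1 ∩ C.1).ncard := by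
      exact_mod_cast hle
    have h2 := ncard_le_ncard (inter_subset_right (s := B'.1)) (hfin C)
    have := hlt B' B hne
    omega

/-! ### Shellings of the independence complex. -/

theorem complexFacets_indepComplex (M : Matroid α) :
    complexFacets (indepComplex M) = {B | M.IsBase B} := by
  ext B
  exact Matroid.isBase_iff_maximal_indep.symm

theorem isComplex_indepComplex (M : Matroid α) [M.Finite] : IsComplex (indepComplex M) :=
  ⟨M.ground_finite.finite_subsets.subset fun _ hI => hI.subset_ground, ⟨∅, M.empty_indep⟩,
    fun _ hF _ hG => hF.subset hG⟩

theorem isPure_indepComplex (M : Matroid α) : IsPure (indepComplex M) := by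
  rw [IsPure, complexFacets_indepComplex]
  intro B hB B' hB'
  rw [faceDim, faceDim, hB.ncard_eq_ncard_of_isBase hB']

theorem complexDim_eq_faceDim {Δ : Set (Set α)} {F : Set α} (hF : F ∈ Δ)
    (h : ∀ G ∈ Δ, G.ncard ≤ F.ncard) : complexDim Δ = faceDim F := by
  refine IsGreatest.csSup_eq ⟨mem_image_of_mem _ hF, ?_⟩
  rintro _ ⟨G, hG, rfl⟩
  have := h G hG
  simp only [faceDim]
  omega

theorem complexDim_indepComplex {B : Set α} (hB : M.IsBase B) :
    complexDim (indepComplex M) = faceDim B := by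
  refine complexDim_eq_faceDim hB.indep fun I hI => ?_
  obtain ⟨B', hB', hIB'⟩ := Matroid.Indep.exists_isBase_superset hI
  rw [← hB'.ncard_eq_ncard_of_isBase hB]
  exact ncard_le_ncard hIB' (M.ground_finite.subset hB'.subset_ground)

/-- A listing of the bases is a shelling order of the independence complex if every intersection
of `b j` with an earlier basis is contained in a basis that precedes `b j` and is adjacent to it. -/
theorem isComplexShelling_indepComplex {k : ℕ} (b : Fin k ≃ {B : Set α // M.IsBase B})
    (h : ∀ i j, i < j → ∃ t < j, (b i).1 ∩ (b j).1 ⊆ (b t).1 ∧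
      ((b t).1 ∩ (b j).1).ncard + 1 = (b j).1.ncard) :
    IsComplexShelling (indepComplex M) (fun i => (b i : Set α)) := by
  refine ⟨isComplex_indepComplex M, isPure_indepComplex M,
    Subtype.val_injective.comp b.injective, ?_, fun j hj => ?_⟩
  · rw [complexFacets_indepComplex]
    ext B
    exact ⟨fun ⟨i, hi⟩ => hi ▸ (b i).2, fun hB => ⟨b.symm ⟨B, hB⟩, by simp⟩⟩
  have hfin : (b j).1.Finite := M.ground_finite.subset (b j).2.subset_ground
  set Γ := generated ((fun i => (b i : Set α)) '' Iio j) ∩ generated {(b j : Set α)} with hΓ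
  have hmem : ∀ t < j, (b t).1 ∩ (b j).1 ∈ Γ := fun t ht =>
    ⟨⟨_, mem_image_of_mem _ ht, inter_subset_left⟩, _, rfl, inter_subset_right⟩
  have hridge : ∀ S ∈ Γ, ∃ R ∈ Γ, S ⊆ R ∧ R ⊆ (b j).1 ∧ R.ncard + 1 = (b j).1.ncard := by
    rintro S ⟨⟨_, ⟨i, hi, rfl⟩, hSi⟩, _, rfl, hSj⟩
    obtain ⟨t, htj, hsub, hcard⟩ := h i j hi
    exact ⟨_, hmem t htj, subset_inter ((subset_inter hSi hSj).trans hsub) hSj,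
      inter_subset_right, hcard⟩
  constructor
  · suffices hdim : ∀ S ∈ complexFacets Γ, S.ncard + 1 = (b j).1.ncard by
      intro S hS T hT
      have := hdim S hS
      have := hdim T hT
      simp only [faceDim]
      omega
    intro S hS
    obtain ⟨R, hR, hSR, -, hcard⟩ := hridge S hS.prop
    rwa [hS.eq_of_subset hR hSR]
  -- Since `j` is not the first index, basis 0 precedes it, so a face with `r - 1` elements exists.
  · obtain ⟨R, hR, -, -, hcard⟩ := hridge _ (hmem ⟨0, hj.trans j.2⟩ hj)
    rw [complexDim_indepComplex (b j).2, complexDim_eq_faceDim hR fun S hS => ?_]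
    · simp only [faceDim]
      omega
    · obtain ⟨R', -, hSR', hRj, hcard'⟩ := hridge S hS
      have := ncard_le_ncard hSR' (hfin.subset hRj)
      omega

end Matroid

end MatroidShelling

open MatroidShelling

/-- Here `Q` is any polytope dual to the matroid polytope of `M` (its face poset is the opposite
one, through `Φ`), and `b` lists the bases in the given order, `b i < b j` if and only if
`i < j`. -/
theorem theorem1p1 {α : Type*} (M : Matroid α) [M.Finite]
    {V : Type*} [NormedAddCommGroup V] [NormedSpace ℝ V] [FiniteDimensional ℝ V]
    (Q : Set V) (hQ : MatroidShelling.IsPolytope Q)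
    (Φ : MatroidShelling.Face (MatroidShelling.matroidPolytope M) ≃o
      (MatroidShelling.Face Q)ᵒᵈ)
    {k : ℕ} (b : Fin k ≃ {B : Set α // M.IsBase B})
    (hshell : MatroidShelling.IsPolytopeShelling Q
      (fun i => MatroidShelling.dualFacet M Φ (b i))) :
    MatroidShelling.IsComplexShelling (MatroidShelling.indepComplex M)
      (fun i => (b i : Set α)) := by
  have hconv : Convex ℝ Q := by
    obtain ⟨s, rfl⟩ := hQ
    exact convex_convexHull ℝ _
  have hL : ListsFacets Q fun i => dualFacet M Φ (b i) := IsShellingOfDim.listsFacets hshell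
  refine isComplexShelling_indepComplex b fun i j hij => ?_
  have hI : M.Indep ((b i).1 ∩ (b j).1) := (b i).2.indep.subset Set.inter_subset_left
  set G := supersetFace M ((b i).1 ∩ (b j).1)
  have hAi : Φ (vertexFace M (b i)) ≤ Φ G :=
    Φ.monotone (vertexFace_le_supersetFace Set.inter_subset_left)
  have hAj : Φ (vertexFace M (b j)) ≤ Φ G :=
    Φ.monotone (vertexFace_le_supersetFace Set.inter_subset_right)
  obtain ⟨t, htj, hAt, hdim⟩ := hshell.exists_ridge hconv (OrderDual.ofDual (Φ G)).2 hij hAi hAj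
  let R : Face Q := ⟨_, (hL.isExposed t).inter (hL.isExposed j)⟩
  have hcov : R ⋖ OrderDual.ofDual (Φ (vertexFace M (b j))) :=
    covBy_of_polyDim_le (hL.inter_ssubset htj.ne) hdim
  -- Order reversal turns "covered by the facet" into "covers the vertex".
  have hcov' : vertexFace M (b j) ⋖ Φ.symm (OrderDual.toDual R) := by
    rw [← apply_covBy_apply_iff Φ, Φ.apply_symm_apply]
    exact hcov.toDual
  have htR : vertexFace M (b t) ≤ Φ.symm (OrderDual.toDual R) := by
    rw [Φ.le_symm_apply]
    exact Set.inter_subset_left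
  have htG : vertexFace M (b t) ≤ G := Φ.le_iff_le.1 hAt
  exact ⟨t, htj, subset_of_vertexFace_le_supersetFace hI htG,
    ncard_inter_add_one_of_covBy hcov' htR (b.injective.ne htj.ne)⟩
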